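/- All categories named $\mathcal C$ or $\mathcal G$ below are small, and composition is written from left to right. **Inductive groupoids.** An inductive groupoid is a groupoid $\mathcal G$ with a partial order $\le$ on its set of morphisms such that the objects, ordered by $e\le f\iff 1_e\le 1_f$, form a (meet-)semilattice and, writing $\mathbf d,\mathbf r$ for domain and codomain: (1) $u\le x$, $v\le y$ imply $uv\le xy$ whenever both products exist; (2) $x\le y$ implies $x^{-1}\le y^{-1}$; (3) if $e\le\mathbf d(x)$, there is a unique morphism $e{\downharpoonleft}x\le x$ with domain $e$; (4) if $f\le\mathbf r(x)$, there is a unique morphism $x{\downharpoonright}f\le x$ with codomain $f$. $\mathbf{IG}$ is the category of inductive groupoids and inductive functors, i.e. functors that preserve the order of morphisms and the meets of objects. **Inversive categories.** A category with subobjects is a category $\mathcal C$ with a wide subcategory $\mathcal P$, whose morphisms are called inclusions, such that $\mathcal P$ has at most one morphism between any two objects and no isomorphisms except identities, every inclusion is a monomorphism of $\mathcal C$, and $\varphi,\psi\in\mathcal P$, $\varphi=\alpha\psi$ imply $\alpha\in\mathcal P$. Write $c\le d$ if there is an inclusion $\iota(c,d)\colon c\to d$. A retraction is a morphism $q\colon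 d\to c$ with $\iota(c,d)q=1_c$ for some inclusion $\iota(c,d)$. A normal factorisation of $\varphi$ is an expression $\varphi=\theta\sigma\iota$ with $\theta$ a retraction, $\sigma$ an isomorphism and $\iota$ an inclusion; the codomain of $\theta$ is the coimage $\operatorname{coim}\varphi$, and $\varphi^\circ:=\theta\sigma$ is the epimorphic component. A cone with apex $d$ is a family of morphisms $\gamma(a)\colon a\to d$, one for each object $a$, with $\iota(a,b)\gamma(b)=\gamma(a)$ whenever $a\le b$; it is idempotent if $\gamma(d)=1_d$, and inversive if there is exactly one object $m$ for which $\gamma(m)$ is an isomorphism and $\operatorname{coim}\gamma(c)=c\wedge m$ for all objects $c$. The pair $(\mathcal C,\mathcal P)$ is an inversive category if: 1. it is a category with subobjects whose objects form a semilattice under $\le$; 2. every inclusion $\iota(c,d)$ splits uniquely, i.e. $\iota(c,d)q=1_c$ for exactly one $q=q(d,c)$; 3. every morphism has a unique normal factorisation; 4. every product $f=\iota(c_1,c_2)q(c_2,c_3)\cdots\iota(c_{2n-1},c_{2n})q(c_{2n},c_{2n+1})$ of inclusions and retractions satisfies $f=q(c_1,d)\iota(d,c_{2n+1})$, where $d=c_1\wedge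 c_3\wedge\cdots\wedge c_{2n+1}$; 5. every object is the apex of exactly one idempotent inversive cone. $\mathbf{IC}$ is the category of inversive categories and inversive functors, i.e. functors that preserve inclusions and the meets of objects. **The two constructions.** For an inversive category $\mathcal C$, let $\mathcal G_{\mathcal C}$ be the groupoid of all isomorphisms of $\mathcal C$, where for $f$ with domain $c$ and $g$ with domain $d$ we put $f\le g$ iff $c\le d$ and $f=(\iota(c,d)g)^\circ$. For an inductive groupoid $\mathcal G$, let $\mathcal C_{\mathcal G}$ be the category with the objects of $\mathcal G$ whose morphisms $e\to f$ are the triples $[e,\alpha,f\rangle$ with $\alpha$ a morphism of $\mathcal G$, $\mathbf d(\alpha)\le e$ and $\mathbf r(\alpha)\le f$, with composition $$[e,\alpha,f\rangle\,[f,\beta,g\rangle=[e,(\alpha{\downharpoonright}h)(h{\downharpoonleft}\beta),g\rangle,\qquad h=\mathbf r(\alpha)\wedge\mathbf d(\beta),$$ and whose inclusions are the triples $[e,1_e,f\rangle$ with $e\le f$. Each $\mathcal G_{\mathcal C}$ is an inductive groupoid and each $\mathcal C_{\mathcal G}$ is an inversive category; $\mathcal C\mapsto\mathcal G_{\mathcal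 C}$ extends to a functor $\mathbf{IC}\to\mathbf{IG}$ by restricting inversive functors to isomorphisms, and $\mathcal G\mapsto\mathcal C_{\mathcal G}$ extends to a functor $\mathbf{IG}\to\mathbf{IC}$ by $F\mapsto\big([e,\alpha,f\rangle\mapsto[F(e),F(\alpha),F(f)\rangle\big)$. **Theorem.** The category $\mathbf{IG}$ of inductive groupoids is equivalent to the category $\mathbf{IC}$ of inversive categories. More precisely, the functors $\mathcal G\mapsto\mathcal C_{\mathcal G}$ and $\mathcal C\mapsto\mathcal G_{\mathcal C}$ are mutually quasi-inverse equivalences of categories. -/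

import Mathlib

open CategoryTheory

universe u

namespace IGIC

/-! ### Categories with subobjects and inversive categories

Composition is written in diagrammatic order, `f ≫ g` being "first `f`, then `g`".
A wide subcategory is given by the class `P` of its morphisms, the *inclusions*. -/

section Inversive

variable {C : Type u} [SmallCategory C]

/-- `(C, P)` is a category with subobjects: `P` is (the class of morphisms of) a wide subcategory
which is a strict preorder, consists of monomorphisms of `C`, and satisfies: if `φ, ψ ∈ P` and
`φ = α ≫ ψ`, then `α ∈ P`. -/
structure IsSubobjectCategory (P : MorphismProperty C) : Prop where
  id_mem : ∀ a : C, P (𝟙 a)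
  comp_mem : ∀ {a b c : C} (f : a ⟶ b) (g : b ⟶ c), P f → P g → P (f ≫ g)
  /-- `P` is a preorder -/
  thin : ∀ {a b : C} (f g : a ⟶ b), P f → P g → f = g
  /-- the only isomorphisms of the category `P` are the identities -/
  strict : ∀ {a b : C} (f : a ⟶ b) (g : b ⟶ a), P f → P g → f ≫ g = 𝟙 a → g ≫ f = 𝟙 b →
    ∃ h : a = b, f = eqToHom h
  mono : ∀ {a b : C} (f : a ⟶ b), P f → Mono f
  cancel : ∀ {a b c : C} (α : a ⟶ b) (ψ : b ⟶ c), P ψ → P (α ≫ ψ) → P α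

/-- `a ≤ b`: there is an inclusion from `a` to `b`. -/
def SubLE (P : MorphismProperty C) (a b : C) : Prop := ∃ f : a ⟶ b, P f

/-- `d` is the meet (greatest lower bound) of `a` and `b` for the relation `r`. -/
def IsMeet {X : Type u} (r : X → X → Prop) (a b d : X) : Prop :=
  r d a ∧ r d b ∧ ∀ x, r x a → r x b → r x d

/-- A semilattice ordered category: a category with subobjects in which any two objects have a
meet. (That `SubLE P` is a partial order follows from `P` being a strict preorder.) -/
structure IsSOCategory (P : MorphismProperty C) : Prop extends IsSubobjectCategory P where
  exists_meet : ∀ a b : C, ∃ d : C, IsMeet (SubLE P) a b d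

/-- `θ : c ⟶ d` is a retraction: it splits some inclusion `d ⟶ c`. -/
def IsRetraction (P : MorphismProperty C) {c d : C} (θ : c ⟶ d) : Prop :=
  ∃ i : d ⟶ c, P i ∧ i ≫ θ = 𝟙 d

/-- A normal factorisation `f = θ ≫ σ ≫ ι`: retraction, isomorphism, inclusion. -/
structure NormalFactorisation (P : MorphismProperty C) {a b : C} (f : a ⟶ b) where
  /-- the coimage -/
  coim : C
  /-- the image -/
  im : C
  retr : a ⟶ coim
  iso : coim ≅ im
  incl : im ⟶ b
  isRetraction : IsRetraction P retr
  isInclusion : P incl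
  fac : retr ≫ iso.hom ≫ incl = f

/-- The epimorphic component of a morphism with a given normal factorisation. -/
def NormalFactorisation.epi {P : MorphismProperty C} {a b : C} {f : a ⟶ b}
    (n : NormalFactorisation P f) : a ⟶ n.im := n.retr ≫ n.iso.hom

/-- `CoreWord P f d`: the morphism `f : c₁ ⟶ c₂ₙ₊₁` is a product
`ι(c₁,c₂) q(c₂,c₃) ⋯ ι(c₂ₙ₋₁,c₂ₙ) q(c₂ₙ,c₂ₙ₊₁)` of alternating inclusions and retractions, and
`d = c₁ ∧ c₃ ∧ ⋯ ∧ c₂ₙ₊₁`. As identities are both inclusions and retractions, the morphisms `f`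
that occur here are those of the core, that is, of the subcategory generated by the inclusions and
the retractions. -/
inductive CoreWord (P : MorphismProperty C) : ∀ {a b : C}, (a ⟶ b) → C → Prop where
  | nil (a : C) : CoreWord P (𝟙 a) a
  | snoc {a b x e d d' : C} (f : a ⟶ b) (i : b ⟶ x) (q : x ⟶ e) :
      CoreWord P f d → P i → IsRetraction P q → IsMeet (SubLE P) d e d' →
        CoreWord P (f ≫ i ≫ q) d'

/-- A cone with apex `d`. -/
@[ext]
structure SubCone (P : MorphismProperty C) (d : C) where
  app : ∀ a : C, a ⟶ d
  comm : ∀ {a b : C} (i : a ⟶ b), P i → i ≫ app b = app a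

/-- An inversive cone: exactly one component, the one at `m`, is an isomorphism, and the coimage of
the component at `c` is `c ∧ m`. -/
def SubCone.IsInversive {P : MorphismProperty C} {d : C} (γ : SubCone P d) : Prop :=
  ∃ m : C, (∀ c, IsIso (γ.app c) ↔ c = m) ∧
    ∀ c, ∃ n : NormalFactorisation P (γ.app c), IsMeet (SubLE P) c m n.coim

/-- An idempotent cone: its component at its apex is the identity. -/
def SubCone.IsIdempotent {P : MorphismProperty C} {d : C} (γ : SubCone P d) : Prop :=
  γ.app d = 𝟙 d

/-- Inversive categories. -/
structure IsInversive (P : MorphismProperty C) : Prop extends IsSOCategory P where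
  /-- every inclusion splits uniquely -/
  splits : ∀ {a b : C} (i : a ⟶ b), P i → ∃! q : b ⟶ a, i ≫ q = 𝟙 a
  /-- every morphism has a normal factorisation -/
  exists_fac : ∀ {a b : C} (f : a ⟶ b), Nonempty (NormalFactorisation P f)
  /-- the normal factorisation is unique -/
  fac_unique : ∀ {a b : C} (f : a ⟶ b), Subsingleton (NormalFactorisation P f)
  /-- every morphism of the core has an inversive factorisation -/
  core_fac : ∀ {a b d : C} (f : a ⟶ b), CoreWord P f d →
    ∃ (q : a ⟶ d) (i : d ⟶ b), IsRetraction P q ∧ P i ∧ f = q ≫ i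
  /-- every object is the apex of exactly one idempotent inversive cone -/
  exists_cone : ∀ c : C, ∃! γ : SubCone P c, γ.IsInversive ∧ γ.IsIdempotent

/-- A functor between inversive categories is inversive if it preserves inclusions and meets of
objects. -/
structure IsInversiveFunctor {D : Type u} [SmallCategory D] (P : MorphismProperty C)
    (Q : MorphismProperty D) (F : C ⥤ D) : Prop where
  map_incl : ∀ {a b : C} (f : a ⟶ b), P f → Q (F.map f)
  map_meet : ∀ a b d : C, IsMeet (SubLE P) a b d → IsMeet (SubLE Q) (F.obj a) (F.obj b) (F.obj d)

end Inversive

/-- A (small) inversive category. -/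
structure InversiveCat where
  carrier : Type u
  [cat : SmallCategory carrier]
  incl : MorphismProperty carrier
  inversive : IsInversive incl

attribute [instance] InversiveCat.cat

/-- Inversive functors. -/
@[ext]
structure InversiveFunctor (C D : InversiveCat.{u}) where
  functor : C.carrier ⥤ D.carrier
  inversive : IsInversiveFunctor C.incl D.incl functor

/-- The category `IC` of small inversive categories and inversive functors. -/
instance : Category InversiveCat.{u} where
  Hom := InversiveFunctor
  id C := ⟨𝟭 _, ⟨fun _ h => h, fun _ _ _ h => h⟩⟩
  comp F G := ⟨F.functor ⋙ G.functor,
    ⟨fun f h => G.inversive.map_incl _ (F.inversive.map_incl f h),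
      fun a b d h => G.inversive.map_meet _ _ _ (F.inversive.map_meet a b d h)⟩⟩

/-! ### Inductive groupoids -/

/-- The set of all morphisms of a category. -/
@[ext]
structure Mor (G : Type u) [SmallCategory G] where
  {dom : G}
  {cod : G}
  hom : dom ⟶ cod

/-- The order on the objects of a groupoid induced by the order on its morphisms. -/
def ObjLE {G : Type u} [SmallGroupoid G] [PartialOrder (Mor G)] (e f : G) : Prop :=
  Mor.mk (𝟙 e) ≤ Mor.mk (𝟙 f)

/-- Inductive groupoids: groupoids with a partial order on the set of morphisms. -/
class IsInductive (G : Type u) [SmallGroupoid G] [PartialOrder (Mor G)] : Prop where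
  exists_meet : ∀ e f : G, ∃ d : G, IsMeet ObjLE e f d
  comp_le : ∀ {a b c a' b' c' : G} (f : a ⟶ b) (g : b ⟶ c) (x : a' ⟶ b') (y : b' ⟶ c'),
    Mor.mk f ≤ Mor.mk x → Mor.mk g ≤ Mor.mk y → Mor.mk (f ≫ g) ≤ Mor.mk (x ≫ y)
  inv_le : ∀ {a b a' b' : G} (x : a ⟶ b) (y : a' ⟶ b'), Mor.mk x ≤ Mor.mk y →
    Mor.mk (Groupoid.inv x) ≤ Mor.mk (Groupoid.inv y)
  /-- restrictions -/
  restr : ∀ (e : G) (x : Mor G), ObjLE e x.dom → ∃! y : Mor G, y ≤ x ∧ y.dom = e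
  /-- corestrictions -/
  corestr : ∀ (f : G) (x : Mor G), ObjLE f x.cod → ∃! y : Mor G, y ≤ x ∧ y.cod = f

/-- Inductive functors: functors that preserve the order of morphisms and meets of objects. -/
structure IsInductiveFunctor {G H : Type u} [SmallGroupoid G] [SmallGroupoid H]
    [PartialOrder (Mor G)] [PartialOrder (Mor H)] (F : G ⥤ H) : Prop where
  map_le : ∀ {a b a' b' : G} (x : a ⟶ b) (y : a' ⟶ b'), Mor.mk x ≤ Mor.mk y →
    Mor.mk (F.map x) ≤ Mor.mk (F.map y)
  map_meet : ∀ a b d : G, IsMeet ObjLE a b d → IsMeet ObjLE (F.obj a) (F.obj b) (F.obj d)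

/-- A (small) inductive groupoid. -/
structure InductiveGrpd where
  carrier : Type u
  [grpd : SmallGroupoid carrier]
  [order : PartialOrder (Mor carrier)]
  [inductive' : IsInductive carrier]

attribute [instance] InductiveGrpd.grpd InductiveGrpd.order InductiveGrpd.inductive'

/-- Inductive functors, bundled. -/
@[ext]
structure InductiveFunctor (G H : InductiveGrpd.{u}) where
  functor : G.carrier ⥤ H.carrier
  inductive' : IsInductiveFunctor functor

/-- The category `IG` of small inductive groupoids and inductive functors. -/
instance : Category InductiveGrpd.{u} where
  Hom := InductiveFunctor
  id G := ⟨𝟭 _, ⟨fun _ _ h => h, fun _ _ _ h => h⟩⟩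
  comp F G := ⟨F.functor ⋙ G.functor,
    ⟨fun x y h => G.inductive'.map_le _ _ (F.inductive'.map_le x y h),
      fun a b d h => G.inductive'.map_meet _ _ _ (F.inductive'.map_meet a b d h)⟩⟩

/-! ### The groupoid of isomorphisms of an inversive category -/

section IsoGroupoid

variable {C : Type u} [SmallCategory C]

/-- The relation on the isomorphisms of `C`: `f ≤ g`, where `f` has domain `c` and `g` has
domain `d`, if there is an inclusion `i : c ⟶ d` and `f` is the epimorphic component of
`i ≫ g`. -/
def IsoLE (P : MorphismProperty C) (f g : Mor (Core C)) : Prop :=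
  ∃ i : f.dom.of ⟶ g.dom.of, P i ∧ ∃ n : NormalFactorisation P (i ≫ g.hom.iso.hom),
    Mor.mk n.epi = Mor.mk f.hom.iso.hom

theorem IsSubobjectCategory.antisymm {P : MorphismProperty C} (hP : IsSubobjectCategory P)
    {a b : C} (h : SubLE P a b) (h' : SubLE P b a) : a = b := by
  obtain ⟨f, hf⟩ := h
  obtain ⟨g, hg⟩ := h'
  obtain ⟨e, -⟩ := hP.strict f g hf hg
    (hP.thin _ _ (hP.comp_mem _ _ hf hg) (hP.id_mem _))
    (hP.thin _ _ (hP.comp_mem _ _ hg hf) (hP.id_mem _))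
  exact e

theorem IsSubobjectCategory.subLE_trans {P : MorphismProperty C} (hP : IsSubobjectCategory P)
    {a b c : C} (h : SubLE P a b) (h' : SubLE P b c) : SubLE P a c := by
  obtain ⟨f, hf⟩ := h
  obtain ⟨g, hg⟩ := h'
  exact ⟨_, hP.comp_mem _ _ hf hg⟩

/-- A retraction with a right inverse is an identity. -/
theorem IsSubobjectCategory.retraction_split {P : MorphismProperty C} (hP : IsSubobjectCategory P)
    {a b : C} (q : a ⟶ b) (hq : IsRetraction P q) (x : b ⟶ a) (h : q ≫ x = 𝟙 a) :
    ∃ e : a = b, q = eqToHom e := by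
  obtain ⟨i, hi, hiq⟩ := hq
  have hx : x = i := by
    have := congrArg (i ≫ ·) h
    simpa [← Category.assoc, hiq] using this
  subst hx
  obtain rfl := hP.antisymm ⟨q, hP.cancel q x hi (by rw [h]; exact hP.id_mem _)⟩ ⟨x, hi⟩
  obtain rfl := hP.thin _ _ hi (hP.id_mem _)
  exact ⟨rfl, by simpa using h⟩

/-- Two isomorphisms form a commutative square with inclusions. -/
theorem isoLE_iff {P : MorphismProperty C} (hP : IsSubobjectCategory P)
    {a b a' b' : Core C} (f : a ⟶ b) (g : a' ⟶ b') :
    IsoLE P (Mor.mk f) (Mor.mk g) ↔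
      ∃ (i : a.of ⟶ a'.of) (j : b.of ⟶ b'.of), P i ∧ P j ∧
        i ≫ g.iso.hom = f.iso.hom ≫ j := by
  constructor
  · rintro ⟨i, hi, n, hn⟩
    obtain ⟨b⟩ := b
    obtain ⟨f⟩ := f
    obtain ⟨coim, im, q, s, j, hq, hj, fac⟩ := n
    simp only [NormalFactorisation.epi, Mor.mk.injEq, true_and] at hn
    obtain ⟨h1, h2⟩ := hn
    subst h1
    have h2 := eq_of_heq h2
    refine ⟨i, j, hi, hj, ?_⟩
    change i ≫ g.iso.hom = f.hom ≫ j
    rw [← fac, ← h2, Category.assoc]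
  · rintro ⟨i, j, hi, hj, h⟩
    exact ⟨i, hi, ⟨_, _, 𝟙 _, f.iso, j, ⟨𝟙 _, hP.id_mem _, by simp⟩, hj, by simp [h]⟩,
      by simp [NormalFactorisation.epi]⟩

/-- Restriction of an isomorphism along an inclusion. -/
theorem IsInversive.restr_iso {P : MorphismProperty C} (hP : IsInversive P)
    {a a' b' : C} (i : a ⟶ a') (hi : P i) (g : a' ≅ b') :
    ∃ (b : C) (f : a ≅ b) (j : b ⟶ b'), P j ∧ i ≫ g.hom = f.hom ≫ j := by
  obtain ⟨n⟩ := hP.exists_fac (i ≫ g.hom)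
  obtain ⟨coim, im, q, s, j, hq, hj, fac⟩ := n
  obtain ⟨r, hr, -⟩ := hP.splits i hi
  obtain ⟨rfl, h⟩ := hP.retraction_split q hq (s.hom ≫ j ≫ g.inv ≫ r) (by
    have : (q ≫ s.hom ≫ j) ≫ g.inv ≫ r = 𝟙 a := by rw [fac]; simp [hr]
    simpa using this)
  exact ⟨im, s, j, hj, by rw [← fac, h]; simp⟩

theorem IsInversive.restr_iso_unique {P : MorphismProperty C} (hP : IsInversive P)
    {a b b₁ b' : C} (f : a ≅ b) (f₁ : a ≅ b₁) (j : b ⟶ b') (j₁ : b₁ ⟶ b') (hj : P j)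
    (hj₁ : P j₁) (h : f.hom ≫ j = f₁.hom ≫ j₁) : ∃ e : b = b₁, f₁ = f ≪≫ eqToIso e := by
  have := hP.fac_unique (f.hom ≫ j)
  have key : (⟨_, _, 𝟙 _, f, j, ⟨𝟙 _, hP.id_mem _, by simp⟩, hj, by simp⟩ :
      NormalFactorisation P (f.hom ≫ j)) =
      ⟨_, _, 𝟙 _, f₁, j₁, ⟨𝟙 _, hP.id_mem _, by simp⟩, hj₁, by simp [h]⟩ :=
    Subsingleton.elim _ _
  injection key with _ h1 _ h2 _
  subst h1
  exact ⟨rfl, by simpa using (eq_of_heq h2).symm⟩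

/-- `IsoLE` is a partial order. -/
@[reducible]
def isoOrder {P : MorphismProperty C} (hP : IsInversive P) : PartialOrder (Mor (Core C)) where
  le := IsoLE P
  le_refl f := (isoLE_iff hP.toIsSubobjectCategory f.hom f.hom).2
    ⟨𝟙 _, 𝟙 _, hP.id_mem _, hP.id_mem _, by simp⟩
  le_trans f g k h h' := by
    obtain ⟨i, j, hi, hj, e⟩ := (isoLE_iff hP.toIsSubobjectCategory f.hom g.hom).1 h
    obtain ⟨i', j', hi', hj', e'⟩ := (isoLE_iff hP.toIsSubobjectCategory g.hom k.hom).1 h'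
    refine (isoLE_iff hP.toIsSubobjectCategory f.hom k.hom).2
      ⟨i ≫ i', j ≫ j', hP.comp_mem _ _ hi hi', hP.comp_mem _ _ hj hj', ?_⟩
    rw [Category.assoc, e', ← Category.assoc, e, Category.assoc]
  le_antisymm := by
    rintro ⟨f⟩ ⟨g⟩ h h'
    rename_i a b a' b'
    obtain ⟨i, j, hi, hj, e⟩ := (isoLE_iff hP.toIsSubobjectCategory f g).1 h
    obtain ⟨i', j', hi', hj', e'⟩ := (isoLE_iff hP.toIsSubobjectCategory g f).1 h'
    obtain ⟨a⟩ := a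
    obtain ⟨b⟩ := b
    obtain ⟨a'⟩ := a'
    obtain ⟨b'⟩ := b'
    dsimp only at i j i' j' e e'
    obtain rfl := hP.antisymm ⟨i, hi⟩ ⟨i', hi'⟩
    obtain rfl := hP.antisymm ⟨j, hj⟩ ⟨j', hj'⟩
    obtain rfl := hP.thin _ _ hi (hP.id_mem _)
    obtain rfl := hP.thin _ _ hj (hP.id_mem _)
    obtain rfl : g = f := by
      apply Core.hom_ext
      simpa using e
    rfl

theorem iso_objLE {P : MorphismProperty C} (hP : IsInversive P) (a b : Core C) :
    @ObjLE _ _ (isoOrder hP) a b ↔ SubLE P a.of b.of := by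
  refine (isoLE_iff hP.toIsSubobjectCategory (𝟙 a) (𝟙 b)).trans ⟨?_, ?_⟩
  · rintro ⟨i, j, hi, -⟩
    exact ⟨i, hi⟩
  · rintro ⟨i, hi⟩
    refine ⟨i, i, hi, hi, ?_⟩
    change i ≫ 𝟙 _ = 𝟙 _ ≫ i
    simp

theorem iso_isMeet {P : MorphismProperty C} (hP : IsInversive P) (a b d : Core C) :
    IsMeet (@ObjLE _ _ (isoOrder hP)) a b d ↔ IsMeet (SubLE P) a.of b.of d.of := by
  simp only [IsMeet, iso_objLE]
  exact ⟨fun h => ⟨h.1, h.2.1, fun x => h.2.2 ⟨x⟩⟩, fun h => ⟨h.1, h.2.1, fun x => h.2.2 x.of⟩⟩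

theorem iso_inv_le {P : MorphismProperty C} (hP : IsInversive P) {a b a' b' : Core C}
    (x : a ⟶ b) (y : a' ⟶ b') (h : IsoLE P (Mor.mk x) (Mor.mk y)) :
    IsoLE P (Mor.mk (Groupoid.inv x)) (Mor.mk (Groupoid.inv y)) := by
  obtain ⟨i, j, hi, hj, e⟩ := (isoLE_iff hP.toIsSubobjectCategory x y).1 h
  refine (isoLE_iff hP.toIsSubobjectCategory _ _).2 ⟨j, i, hj, hi, ?_⟩
  change j ≫ y.iso.inv = x.iso.inv ≫ i
  rw [Iso.comp_inv_eq, Category.assoc, e, Iso.inv_hom_id_assoc]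

theorem iso_restr {P : MorphismProperty C} (hP : IsInversive P) (e : Core C) (x : Mor (Core C))
    (h : SubLE P e.of x.dom.of) : ∃! y : Mor (Core C), IsoLE P y x ∧ y.dom = e := by
  obtain ⟨x⟩ := x
  obtain ⟨i, hi⟩ := h
  obtain ⟨b, f, j, hj, hf⟩ := hP.restr_iso i hi x.iso
  refine ⟨⟨(⟨f⟩ : e ⟶ ⟨b⟩)⟩, ⟨(isoLE_iff hP.toIsSubobjectCategory _ _).2
    ⟨i, j, hi, hj, hf⟩, rfl⟩, ?_⟩
  rintro ⟨y⟩ ⟨hy, rfl⟩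
  obtain ⟨i', j', hi', hj', e'⟩ := (isoLE_iff hP.toIsSubobjectCategory y x).1 hy
  obtain rfl := hP.thin _ _ hi hi'
  rename_i c d
  obtain ⟨d⟩ := d
  obtain ⟨y⟩ := y
  obtain ⟨rfl, rfl⟩ := hP.restr_iso_unique y f j' j hj' hj (e'.symm.trans hf)
  simp

theorem iso_isInductive {P : MorphismProperty C} (hP : IsInversive P) :
    @IsInductive (Core C) _ (isoOrder hP) :=
  letI := isoOrder hP
  { exists_meet := fun e f => by
      obtain ⟨d, hd⟩ := hP.exists_meet e.of f.of
      exact ⟨⟨d⟩, (iso_isMeet hP e f ⟨d⟩).2 hd⟩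
    comp_le := fun f g x y h h' => by
      obtain ⟨i, j, hi, hj, e⟩ := (isoLE_iff hP.toIsSubobjectCategory f x).1 h
      obtain ⟨i', j', hi', hj', e'⟩ := (isoLE_iff hP.toIsSubobjectCategory g y).1 h'
      obtain rfl := hP.thin _ _ hj hi'
      refine (isoLE_iff hP.toIsSubobjectCategory _ _).2 ⟨i, j', hi, hj', ?_⟩
      change i ≫ x.iso.hom ≫ y.iso.hom = (f.iso.hom ≫ g.iso.hom) ≫ j'
      rw [← Category.assoc, e, Category.assoc, e', Category.assoc]
    inv_le := fun x y h => iso_inv_le hP x y h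
    restr := fun e x h => iso_restr hP e x ((iso_objLE hP _ _).1 h)
    corestr := fun e x h => by
      obtain ⟨x⟩ := x
      obtain ⟨y, ⟨hy, hye⟩, hu⟩ := iso_restr hP e ⟨Groupoid.inv x⟩ ((iso_objLE hP _ _).1 h)
      refine ⟨⟨Groupoid.inv y.hom⟩, ⟨?_, hye⟩, ?_⟩
      · have := iso_inv_le hP y.hom (Groupoid.inv x) hy
        exact this
      · rintro ⟨z⟩ ⟨hz, hze⟩
        have := hu ⟨Groupoid.inv z⟩ ⟨iso_inv_le hP z x hz, hze⟩
        subst this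
        rfl }

/-- The inductive groupoid of isomorphisms of an inversive category. -/
def isoGrpd (C : InversiveCat.{u}) : InductiveGrpd.{u} :=
  letI := isoOrder C.inversive
  haveI := iso_isInductive C.inversive
  ⟨Core C.carrier⟩

/-- The functor `IC ⥤ IG` sending an inversive category to its groupoid of isomorphisms and an
inversive functor to its restriction. -/
def isoFunctor : InversiveCat.{u} ⥤ InductiveGrpd.{u} where
  obj := isoGrpd
  map {C D} F :=
    { functor := F.functor.core
      inductive' :=
        { map_le := fun x y h => by
            obtain ⟨i, j, hi, hj, e⟩ := (isoLE_iff C.inversive.toIsSubobjectCategory x y).1 h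
            refine (isoLE_iff D.inversive.toIsSubobjectCategory _ _).2
              ⟨F.functor.map i, F.functor.map j, F.inversive.map_incl _ hi,
                F.inversive.map_incl _ hj, ?_⟩
            change F.functor.map i ≫ F.functor.map y.iso.hom =
              F.functor.map x.iso.hom ≫ F.functor.map j
            rw [← Functor.map_comp, e, Functor.map_comp]
          map_meet := fun a b d h => (iso_isMeet D.inversive _ _ _).2
            (F.inversive.map_meet _ _ _ ((iso_isMeet C.inversive _ _ _).1 h)) } }
  map_id _ := rfl
  map_comp _ _ := rfl

end IsoGroupoid

/-! ### The category of triples of an inductive groupoid -/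

section Triples

section Order

variable {G : Type u} [SmallGroupoid G] [PartialOrder (Mor G)]

theorem objLE_refl (a : G) : ObjLE a a := le_refl (Mor.mk (𝟙 a))

theorem objLE_trans {a b c : G} (h : ObjLE a b) (h' : ObjLE b c) : ObjLE a c :=
  le_trans (α := Mor G) h h'

theorem objLE_antisymm {a b : G} (h : ObjLE a b) (h' : ObjLE b a) : a = b :=
  congrArg Mor.dom (le_antisymm (α := Mor G) h h')

theorem isMeet_unique {a b d d' : G} (h : IsMeet ObjLE a b d) (h' : IsMeet ObjLE a b d') :
    d = d' :=
  objLE_antisymm (h'.2.2 _ h.1 h.2.1) (h.2.2 _ h'.1 h'.2.1)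

/-- `m` is the greatest product `u ≫ v` with `u ≤ α` and `v ≤ β`. -/
def IsPP {a b c d : G} (α : a ⟶ b) (β : c ⟶ d) (m : Mor G) : Prop :=
  (∃ (x y z : G) (u : x ⟶ y) (v : y ⟶ z), Mor.mk u ≤ Mor.mk α ∧ Mor.mk v ≤ Mor.mk β ∧
    m = Mor.mk (u ≫ v)) ∧
  ∀ (x y z : G) (u : x ⟶ y) (v : y ⟶ z), Mor.mk u ≤ Mor.mk α → Mor.mk v ≤ Mor.mk β →
    Mor.mk (u ≫ v) ≤ m

theorem IsPP.unique {a b c d : G} {α : a ⟶ b} {β : c ⟶ d} {m m' : Mor G} (h : IsPP α β m)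
    (h' : IsPP α β m') : m = m' := by
  obtain ⟨⟨x, y, z, u, v, hu, hv, rfl⟩, h⟩ := h
  obtain ⟨⟨x', y', z', u', v', hu', hv', rfl⟩, h'⟩ := h'
  exact le_antisymm (h' _ _ _ _ _ hu hv) (h _ _ _ _ _ hu' hv')

variable [IsInductive G]

theorem dom_le {a b a' b' : G} {x : a ⟶ b} {y : a' ⟶ b'} (h : Mor.mk x ≤ Mor.mk y) :
    ObjLE a a' := by
  simpa [ObjLE] using IsInductive.comp_le _ _ _ _ h (IsInductive.inv_le _ _ h)

theorem cod_le {a b a' b' : G} {x : a ⟶ b} {y : a' ⟶ b'} (h : Mor.mk x ≤ Mor.mk y) :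
    ObjLE b b' := by
  simpa [ObjLE] using IsInductive.comp_le _ _ _ _ (IsInductive.inv_le _ _ h) h

theorem exists_restr {a b : G} (x : a ⟶ b) {e : G} (h : ObjLE e a) :
    ∃ (z : G) (y : e ⟶ z), Mor.mk y ≤ Mor.mk x := by
  obtain ⟨⟨y⟩, ⟨hy, rfl⟩, -⟩ := IsInductive.restr e ⟨x⟩ h
  exact ⟨_, y, hy⟩

theorem exists_corestr {a b : G} (x : a ⟶ b) {e : G} (h : ObjLE e b) :
    ∃ (z : G) (y : z ⟶ e), Mor.mk y ≤ Mor.mk x := by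
  obtain ⟨⟨y⟩, ⟨hy, rfl⟩, -⟩ := IsInductive.corestr e ⟨x⟩ h
  exact ⟨_, y, hy⟩

theorem restr_unique {x y y' : Mor G} (h : y ≤ x) (h' : y' ≤ x) (e : y.dom = y'.dom) : y = y' :=
  (IsInductive.restr y.dom x (dom_le h)).unique ⟨h, rfl⟩ ⟨h', e.symm⟩

theorem corestr_unique {x y y' : Mor G} (h : y ≤ x) (h' : y' ≤ x) (e : y.cod = y'.cod) :
    y = y' :=
  (IsInductive.corestr y.cod x (cod_le h)).unique ⟨h, rfl⟩ ⟨h', e.symm⟩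

theorem le_of_dom_le {x y y' : Mor G} (h : y ≤ x) (h' : y' ≤ x) (e : ObjLE y.dom y'.dom) :
    y ≤ y' := by
  obtain ⟨z, w, hw⟩ := exists_restr y'.hom e
  have : Mor.mk w = y := restr_unique (hw.trans h') h rfl
  exact this ▸ hw

theorem le_of_cod_le {x y y' : Mor G} (h : y ≤ x) (h' : y' ≤ x) (e : ObjLE y.cod y'.cod) :
    y ≤ y' := by
  obtain ⟨z, w, hw⟩ := exists_corestr y'.hom e
  have : Mor.mk w = y := corestr_unique (hw.trans h') h rfl
  exact this ▸ hw

theorem eq_id_of_le {a b e : G} {x : a ⟶ b} (h : Mor.mk x ≤ Mor.mk (𝟙 e)) :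
    Mor.mk x = Mor.mk (𝟙 a) :=
  restr_unique h (dom_le h) rfl

theorem isPP_of_isMeet {a b c d x y z : G} {α : a ⟶ b} {β : c ⟶ d} {u : x ⟶ y} {v : y ⟶ z}
    (hy : IsMeet ObjLE b c y) (hu : Mor.mk u ≤ Mor.mk α) (hv : Mor.mk v ≤ Mor.mk β) :
    IsPP α β (Mor.mk (u ≫ v)) := by
  refine ⟨⟨_, _, _, u, v, hu, hv, rfl⟩, fun x' y' z' u' v' hu' hv' => ?_⟩
  have : ObjLE y' y := hy.2.2 _ (cod_le hu') (dom_le hv')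
  exact IsInductive.comp_le _ _ _ _ (le_of_cod_le hu' hu this) (le_of_dom_le hv' hv this)

theorem isPP_comp {a b c : G} (α : a ⟶ b) (β : b ⟶ c) : IsPP α β (Mor.mk (α ≫ β)) :=
  ⟨⟨_, _, _, α, β, le_refl _, le_refl _, rfl⟩,
    fun _ _ _ _ _ hu hv => IsInductive.comp_le _ _ _ _ hu hv⟩

theorem isPP_id_left {c d e : G} (β : c ⟶ d) (h : ObjLE c e) : IsPP (𝟙 e) β (Mor.mk β) := by
  refine ⟨⟨_, _, _, 𝟙 c, β, h, le_refl _, by simp⟩, fun x y z u v hu hv => ?_⟩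
  obtain rfl : y = x := congrArg Mor.cod (eq_id_of_le hu)
  obtain rfl : u = 𝟙 y := by simpa using eq_id_of_le hu
  simpa using hv

theorem isPP_id_right {a b e : G} (α : a ⟶ b) (h : ObjLE b e) : IsPP α (𝟙 e) (Mor.mk α) := by
  refine ⟨⟨_, _, _, α, 𝟙 b, le_refl _, h, by simp⟩, fun x y z u v hu hv => ?_⟩
  obtain rfl : z = y := congrArg Mor.cod (eq_id_of_le hv)
  obtain rfl : v = 𝟙 z := by simpa using eq_id_of_le hv
  simpa using hu

theorem isPP_id_id {e f d : G} (h : IsMeet ObjLE e f d) :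
    IsPP (𝟙 e) (𝟙 f) (Mor.mk (𝟙 d)) := by
  simpa using isPP_of_isMeet (u := 𝟙 d) (v := 𝟙 d) h h.1 h.2.1

theorem isPP_assoc {a b c d e f p q r s : G} {α : a ⟶ b} {β : c ⟶ d} {γ : e ⟶ f}
    {m : p ⟶ q} {n : r ⟶ s} {t t' : Mor G} (hm : IsPP α β (Mor.mk m)) (hn : IsPP β γ (Mor.mk n))
    (h : IsPP m γ t) (h' : IsPP α n t') : t = t' := by
  apply le_antisymm
  · obtain ⟨⟨x, y, z, u, v, hu, hv, rfl⟩, -⟩ := h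
    obtain ⟨⟨x₁, y₁, z₁, u₁, v₁, hu₁, hv₁, e₁⟩, -⟩ := hm
    rw [e₁] at hu
    obtain ⟨y₂, v₂, hv₂⟩ := exists_corestr v₁ (e := y) (cod_le hu)
    obtain ⟨x₂, u₂, hu₂⟩ := exists_corestr u₁ (e := y₂) (dom_le hv₂)
    have : Mor.mk (u₂ ≫ v₂) = Mor.mk u :=
      corestr_unique (IsInductive.comp_le _ _ _ _ hu₂ hv₂) hu rfl
    obtain rfl : x₂ = x := congrArg Mor.dom this
    obtain rfl : u₂ ≫ v₂ = u := by simpa using this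
    rw [Category.assoc]
    exact h'.2 _ _ _ _ _ (hu₂.trans hu₁) (hn.2 _ _ _ _ _ (hv₂.trans hv₁) hv)
  · obtain ⟨⟨x, y, z, u, v, hu, hv, rfl⟩, -⟩ := h'
    obtain ⟨⟨x₁, y₁, z₁, u₁, v₁, hu₁, hv₁, e₁⟩, -⟩ := hn
    rw [e₁] at hv
    obtain ⟨y₂, u₂, hu₂⟩ := exists_restr u₁ (e := y) (dom_le hv)
    obtain ⟨z₂, v₂, hv₂⟩ := exists_restr v₁ (e := y₂) (cod_le hu₂)
    have : Mor.mk (u₂ ≫ v₂) = Mor.mk v :=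
      restr_unique (IsInductive.comp_le _ _ _ _ hu₂ hv₂) hv rfl
    obtain rfl : z₂ = z := congrArg Mor.cod this
    obtain rfl : u₂ ≫ v₂ = v := by simpa using this
    rw [← Category.assoc]
    exact h.2 _ _ _ _ _ (hm.2 _ _ _ _ _ hu (hu₂.trans hu₁)) (hv₂.trans hv₁)

end Order

/-- The objects of the category of triples of `G`: those of `G`. -/
structure TripleCat (G : Type u) where
  of : G

/-- A morphism `[e, arr, f⟩` from `e` to `f`, that is, a triple consisting of the unique formal
retraction from `e` to `dom ≤ e`, a morphism `arr : dom ⟶ cod` of the groupoid and the unique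
formal inclusion from `cod ≤ f` to `f`. -/
structure Triple {G : Type u} [SmallGroupoid G] [PartialOrder (Mor G)] (e f : TripleCat G) where
  {dom : G}
  {cod : G}
  arr : dom ⟶ cod
  dom_le : ObjLE dom e.of
  cod_le : ObjLE cod f.of

variable {G : Type u} [SmallGroupoid G] [PartialOrder (Mor G)]

/-- The groupoid component of a triple. -/
def Triple.mor {e f : TripleCat G} (T : Triple e f) : Mor G := Mor.mk T.arr

theorem Triple.ext {e f : TripleCat G} {T S : Triple e f} (h : T.mor = S.mor) : T = S := by
  obtain ⟨t, _, _⟩ := T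
  obtain ⟨s, _, _⟩ := S
  simp only [Triple.mor, Mor.mk.injEq] at h
  obtain ⟨rfl, rfl, h⟩ := h
  obtain rfl := eq_of_heq h
  rfl

variable [IsInductive G]

/-- The meet of two objects. -/
noncomputable def meet (a b : G) : G := (IsInductive.exists_meet a b).choose

theorem meet_spec (a b : G) : IsMeet ObjLE a b (meet a b) :=
  (IsInductive.exists_meet a b).choose_spec

/-- The codomain of the restriction of `x` to `e`. -/
noncomputable def restrCod {a b : G} (x : a ⟶ b) {e : G} (h : ObjLE e a) : G :=
  (exists_restr x h).choose

/-- The restriction of `x` to `e`: the unique morphism below `x` with domain `e`. -/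
noncomputable def restr {a b : G} (x : a ⟶ b) {e : G} (h : ObjLE e a) : e ⟶ restrCod x h :=
  (exists_restr x h).choose_spec.choose

theorem restr_le {a b : G} (x : a ⟶ b) {e : G} (h : ObjLE e a) :
    Mor.mk (restr x h) ≤ Mor.mk x :=
  (exists_restr x h).choose_spec.choose_spec

/-- The domain of the corestriction of `x` to `f`. -/
noncomputable def corestrDom {a b : G} (x : a ⟶ b) {f : G} (h : ObjLE f b) : G :=
  (exists_corestr x h).choose

/-- The corestriction of `x` to `f`: the unique morphism below `x` with codomain `f`. -/
noncomputable def corestr {a b : G} (x : a ⟶ b) {f : G} (h : ObjLE f b) : corestrDom x h ⟶ f :=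
  (exists_corestr x h).choose_spec.choose

theorem corestr_le {a b : G} (x : a ⟶ b) {f : G} (h : ObjLE f b) :
    Mor.mk (corestr x h) ≤ Mor.mk x :=
  (exists_corestr x h).choose_spec.choose_spec

/-- Composition of triples: the composite of `[e, α, f⟩` and `[f, β, g⟩` is `[e, γ, g⟩` where `γ`
is the corestriction of `α` to `h` followed by the restriction of `β` to `h`, with
`h = cod α ∧ dom β`. -/
noncomputable def Triple.comp {e f g : TripleCat G} (T : Triple e f) (S : Triple f g) :
    Triple e g where
  arr := corestr T.arr (meet_spec T.cod S.dom).1 ≫ restr S.arr (meet_spec T.cod S.dom).2.1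
  dom_le := objLE_trans (IGIC.dom_le (corestr_le _ _)) T.dom_le
  cod_le := objLE_trans (IGIC.cod_le (restr_le _ _)) S.cod_le

theorem Triple.isPP_comp {e f g : TripleCat G} (T : Triple e f) (S : Triple f g) :
    IsPP T.arr S.arr (T.comp S).mor :=
  isPP_of_isMeet (meet_spec T.cod S.dom) (corestr_le _ _) (restr_le _ _)

/-- The identity triple. -/
def Triple.id (e : TripleCat G) : Triple e e := ⟨𝟙 e.of, objLE_refl _, objLE_refl _⟩

noncomputable instance : SmallCategory (TripleCat G) where
  Hom := Triple
  id := Triple.id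
  comp := Triple.comp
  id_comp T := Triple.ext ((Triple.isPP_comp _ _).unique (isPP_id_left _ T.dom_le))
  comp_id T := Triple.ext ((Triple.isPP_comp _ _).unique (isPP_id_right _ T.cod_le))
  assoc T S R := Triple.ext (isPP_assoc (Triple.isPP_comp T S) (Triple.isPP_comp S R)
    (Triple.isPP_comp _ _) (Triple.isPP_comp _ _))

/-- The inclusions of the category of triples: the triples `[e, 𝟙 e, f⟩` with `e ≤ f`. -/
def tripleIncl : MorphismProperty (TripleCat G) :=
  fun e _ T => Triple.mor T = Mor.mk (𝟙 e.of)

theorem Triple.hom_ext {e f : TripleCat G} {T S : e ⟶ f} (h : Triple.mor T = Triple.mor S) :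
    T = S := Triple.ext h

theorem Triple.isPP {e f g : TripleCat G} (T : e ⟶ f) (S : f ⟶ g) :
    IsPP T.arr S.arr (Triple.mor (T ≫ S)) := Triple.isPP_comp T S

/-- The inclusion from `e` to `f`. -/
def inclT {e f : TripleCat G} (h : ObjLE e.of f.of) : e ⟶ f :=
  Triple.mk (𝟙 e.of) (objLE_refl _) h

/-- The retraction from `f` to `e`. -/
def retrT {e f : TripleCat G} (h : ObjLE e.of f.of) : f ⟶ e :=
  Triple.mk (𝟙 e.of) h (objLE_refl _)

theorem incl_iff {e f : TripleCat G} (T : e ⟶ f) :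
    tripleIncl T ↔ ∃ h : ObjLE e.of f.of, T = inclT h := by
  constructor
  · intro h
    have h1 : Triple.cod T = e.of := congrArg Mor.cod h
    exact ⟨h1 ▸ T.cod_le, Triple.hom_ext h⟩
  · rintro ⟨h, rfl⟩
    rfl

theorem triple_subLE {e f : TripleCat G} : SubLE tripleIncl e f ↔ ObjLE e.of f.of := by
  constructor
  · rintro ⟨T, hT⟩
    exact ((incl_iff T).1 hT).1
  · exact fun h => ⟨inclT h, rfl⟩

theorem triple_isMeet {e f d : TripleCat G} :
    IsMeet (SubLE tripleIncl) e f d ↔ IsMeet ObjLE e.of f.of d.of := by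
  simp only [IsMeet, triple_subLE]
  exact ⟨fun h => ⟨h.1, h.2.1, fun x => h.2.2 ⟨x⟩⟩, fun h => ⟨h.1, h.2.1, fun x => h.2.2 x.of⟩⟩

theorem mor_comp_incl {e f g : TripleCat G} (T : e ⟶ f) (h : ObjLE f.of g.of) :
    Triple.mor (T ≫ inclT h) = Triple.mor T :=
  (Triple.isPP _ _).unique (isPP_id_right _ T.cod_le)

theorem mor_retr_comp {e f g : TripleCat G} (h : ObjLE f.of e.of) (T : f ⟶ g) :
    Triple.mor (retrT h ≫ T) = Triple.mor T :=
  (Triple.isPP _ _).unique (isPP_id_left _ T.dom_le)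

theorem mor_incl_comp {e f g : TripleCat G} (h : ObjLE e.of f.of) (T : f ⟶ g)
    (h' : ObjLE T.dom e.of) : Triple.mor (inclT h ≫ T) = Triple.mor T :=
  (Triple.isPP _ _).unique (isPP_id_left _ h')

theorem triple_splits {e f : TripleCat G} (h : ObjLE e.of f.of) (q : f ⟶ e) :
    inclT h ≫ q = 𝟙 e ↔ q = retrT h := by
  constructor
  · intro hq
    have h1 : IsPP (𝟙 e.of) q.arr (Mor.mk (𝟙 e.of)) := by
      have := Triple.isPP (inclT h) q
      rwa [hq] at this
    obtain ⟨⟨x, y, z, u, v, hu, hv, e₁⟩, -⟩ := h1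
    obtain rfl : y = x := congrArg Mor.cod (eq_id_of_le hu)
    obtain rfl : u = 𝟙 y := by simpa using eq_id_of_le hu
    rw [Category.id_comp] at e₁
    rw [← e₁] at hv
    apply Triple.hom_ext
    refine corestr_unique (x := q.mor) (le_refl _) hv ?_
    exact objLE_antisymm q.cod_le (cod_le hv)
  · rintro rfl
    exact Triple.hom_ext (mor_incl_comp _ _ (objLE_refl _))

theorem triple_isRetraction {e f : TripleCat G} (q : f ⟶ e) :
    IsRetraction tripleIncl q ↔ ∃ h : ObjLE e.of f.of, q = retrT h := by
  constructor
  · rintro ⟨i, hi, hq⟩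
    obtain ⟨h, rfl⟩ := (incl_iff i).1 hi
    exact ⟨h, (triple_splits h q).1 hq⟩
  · rintro ⟨h, rfl⟩
    exact ⟨inclT h, rfl, (triple_splits h _).2 rfl⟩

theorem dom_of_comp_eq_id {e f : TripleCat G} (T : e ⟶ f) (S : f ⟶ e) (h : T ≫ S = 𝟙 e) :
    Triple.dom T = e.of := by
  have h1 := Triple.isPP T S
  rw [h] at h1
  obtain ⟨⟨x, y, z, u, v, hu, hv, e₁⟩, -⟩ := h1
  obtain rfl : e.of = x := congrArg Mor.dom e₁
  exact objLE_antisymm T.dom_le (dom_le hu)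

theorem cod_of_comp_eq_id {e f : TripleCat G} (T : e ⟶ f) (S : f ⟶ e) (h : S ≫ T = 𝟙 f) :
    Triple.cod T = f.of := by
  have h1 := Triple.isPP S T
  rw [h] at h1
  obtain ⟨⟨x, y, z, u, v, hu, hv, e₁⟩, -⟩ := h1
  obtain rfl : f.of = z := congrArg Mor.cod e₁
  exact objLE_antisymm T.cod_le (cod_le hv)

/-- A morphism of the groupoid as an isomorphism of the category of triples. -/
noncomputable def isoT {a b : G} (α : a ⟶ b) : (⟨a⟩ : TripleCat G) ≅ ⟨b⟩ where
  hom := Triple.mk α (objLE_refl _) (objLE_refl _)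
  inv := Triple.mk (Groupoid.inv α) (objLE_refl _) (objLE_refl _)
  hom_inv_id := Triple.hom_ext ((Triple.isPP _ _).unique (by
    have := isPP_comp α (Groupoid.inv α)
    rwa [Groupoid.comp_inv] at this))
  inv_hom_id := Triple.hom_ext ((Triple.isPP _ _).unique (by
    have := isPP_comp (Groupoid.inv α) α
    rwa [Groupoid.inv_comp] at this))

theorem triple_isSubobjectCategory :
    IsSubobjectCategory (tripleIncl : MorphismProperty (TripleCat G)) where
  id_mem _ := rfl
  comp_mem f g hf hg := by
    obtain ⟨h, rfl⟩ := (incl_iff g).1 hg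
    exact (mor_comp_incl f h).trans hf
  thin f g hf hg := Triple.hom_ext (Eq.trans hf (Eq.symm hg))
  strict {a b} f g hf hg _ _ := by
    obtain ⟨h, rfl⟩ := (incl_iff f).1 hf
    obtain ⟨h', rfl⟩ := (incl_iff g).1 hg
    obtain ⟨a⟩ := a
    obtain ⟨b⟩ := b
    obtain rfl : a = b := objLE_antisymm h h'
    exact ⟨rfl, rfl⟩
  mono f hf := by
    obtain ⟨h, rfl⟩ := (incl_iff f).1 hf
    refine ⟨fun u v huv => Triple.hom_ext ?_⟩
    rw [← mor_comp_incl u h, huv, mor_comp_incl]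
  cancel α ψ hψ h := by
    obtain ⟨h', rfl⟩ := (incl_iff ψ).1 hψ
    exact (mor_comp_incl α h').symm.trans h

/-- The normal factorisation of a triple. -/
noncomputable def tripleFac {e f : TripleCat G} (T : e ⟶ f) : NormalFactorisation tripleIncl T where
  coim := ⟨T.dom⟩
  im := ⟨T.cod⟩
  retr := retrT T.dom_le
  iso := isoT T.arr
  incl := inclT T.cod_le
  isRetraction := (triple_isRetraction _).2 ⟨_, rfl⟩
  isInclusion := rfl
  fac := Triple.hom_ext ((mor_retr_comp _ _).trans (mor_comp_incl _ _))

theorem tripleFac_unique {e f : TripleCat G} (T : e ⟶ f) (n : NormalFactorisation tripleIncl T) :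
    n = tripleFac T := by
  obtain ⟨⟨x⟩, ⟨y⟩, q, s, j, hq, hj, fac⟩ := n
  obtain ⟨h, rfl⟩ := (triple_isRetraction _).1 hq
  obtain ⟨h', rfl⟩ := (incl_iff _).1 hj
  have h1 := dom_of_comp_eq_id s.hom s.inv s.hom_inv_id
  have h2 := cod_of_comp_eq_id s.hom s.inv s.inv_hom_id
  have h3 : Triple.mor s.hom = Triple.mor T := by
    rw [← fac, mor_retr_comp, mor_comp_incl]
  obtain ⟨τ, l, l'⟩ := T
  have h1' := congrArg Mor.dom h3
  have h2' := congrArg Mor.cod h3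
  dsimp only [Triple.mor] at h1' h2'
  obtain rfl := h1.symm.trans h1'
  obtain rfl := h2.symm.trans h2'
  obtain rfl : s = isoT τ := Iso.ext (Triple.hom_ext h3)
  rfl

theorem triple_coreWord {e f d : TripleCat G} (T : e ⟶ f) (h : CoreWord tripleIncl T d) :
    Triple.mor T = Mor.mk (𝟙 d.of) ∧ ObjLE d.of e.of ∧ ObjLE d.of f.of := by
  induction h with
  | nil => exact ⟨rfl, objLE_refl _, objLE_refl _⟩
  | snoc f i q _ hi hq hd ih =>
    obtain ⟨hi', rfl⟩ := (incl_iff i).1 hi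
    obtain ⟨hq', rfl⟩ := (triple_isRetraction q).1 hq
    obtain ⟨ih, ih1, ih2⟩ := ih
    have hd := triple_isMeet.1 hd
    refine ⟨?_, objLE_trans hd.1 ih1, hd.2.1⟩
    have h1 := Triple.isPP (f ≫ inclT hi') (retrT hq')
    rw [← Category.assoc]
    refine h1.unique ?_
    have h2 : Triple.mor (f ≫ inclT hi') = Mor.mk (𝟙 _) := (mor_comp_incl f hi').trans ih
    generalize f ≫ inclT hi' = S at h2
    obtain ⟨σ, l, l'⟩ := S
    have e1 := congrArg Mor.dom h2
    have e2 := congrArg Mor.cod h2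
    dsimp only [Triple.mor] at e1 e2
    subst e1
    subst e2
    obtain rfl : σ = 𝟙 _ := by simpa [Triple.mor] using h2
    exact isPP_id_id hd

/-- The cone with apex `c` whose component at `g` is `[g, 𝟙 (g ∧ c), c⟩`. -/
noncomputable def tripleCone (c : TripleCat G) :
    SubCone (tripleIncl : MorphismProperty (TripleCat G)) c where
  app g := Triple.mk (𝟙 (meet g.of c.of)) (meet_spec _ _).1 (meet_spec _ _).2.1
  comm {a b} i hi := by
    obtain ⟨h, rfl⟩ := (incl_iff i).1 hi
    refine Triple.hom_ext ((Triple.isPP _ _).unique (isPP_id_id ?_))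
    have h1 := meet_spec a.of c.of
    have h2 := meet_spec b.of c.of
    exact ⟨h1.1, h2.2.2 _ (objLE_trans h1.1 h) h1.2.1,
      fun x hx hx' => h1.2.2 _ hx (objLE_trans hx' h2.2.1)⟩

theorem meet_self (a : G) : meet a a = a :=
  isMeet_unique (meet_spec a a) ⟨objLE_refl _, objLE_refl _, fun _ h _ => h⟩

theorem tripleCone_idempotent (c : TripleCat G) : (tripleCone c).IsIdempotent := by
  refine Triple.hom_ext ?_
  change Mor.mk (𝟙 (meet c.of c.of)) = Mor.mk (𝟙 c.of)
  rw [meet_self]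

theorem tripleCone_inversive (c : TripleCat G) : (tripleCone c).IsInversive := by
  refine ⟨c, fun g => ⟨fun h => ?_, ?_⟩, fun g => ⟨tripleFac _, triple_isMeet.2 (meet_spec _ _)⟩⟩
  · have h1 := dom_of_comp_eq_id _ _ (IsIso.hom_inv_id ((tripleCone c).app g))
    have h2 := cod_of_comp_eq_id _ _ (IsIso.inv_hom_id ((tripleCone c).app g))
    have : g.of = c.of := h1.symm.trans h2
    obtain ⟨g⟩ := g
    obtain ⟨c⟩ := c
    exact congrArg TripleCat.mk this
  · rintro rfl
    have h : (tripleCone g).app g = 𝟙 g := tripleCone_idempotent g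
    rw [h]
    infer_instance

theorem triple_isInversive : IsInversive (tripleIncl : MorphismProperty (TripleCat G)) where
  toIsSubobjectCategory := triple_isSubobjectCategory
  exists_meet a b := ⟨⟨meet a.of b.of⟩, triple_isMeet.2 (meet_spec _ _)⟩
  splits i hi := by
    obtain ⟨h, rfl⟩ := (incl_iff i).1 hi
    exact ⟨retrT h, (triple_splits h _).2 rfl, fun q => (triple_splits h q).1⟩
  exists_fac f := ⟨tripleFac f⟩
  fac_unique f := ⟨fun n n' => (tripleFac_unique f n).trans (tripleFac_unique f n').symm⟩
  core_fac {a b d} f h := by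
    obtain ⟨h1, h2, h3⟩ := triple_coreWord f h
    exact ⟨retrT h2, inclT h3, (triple_isRetraction _).2 ⟨_, rfl⟩, rfl,
      Triple.hom_ext (h1.trans (mor_retr_comp h2 (inclT h3)).symm)⟩
  exists_cone c := by
    refine ⟨tripleCone c, ⟨tripleCone_inversive c, tripleCone_idempotent c⟩, ?_⟩
    rintro γ ⟨⟨m, hm, hγ⟩, hc⟩
    obtain rfl : c = m := (hm c).1 (by rw [hc]; infer_instance)
    ext g
    obtain ⟨n, hn⟩ := hγ g
    rw [tripleFac_unique _ n] at hn
    have hn := triple_isMeet.1 hn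
    change IsMeet ObjLE g.of c.of (Triple.dom (γ.app g)) at hn
    have e1 := γ.comm (inclT (e := ⟨Triple.dom (γ.app g)⟩) (f := g) hn.1) rfl
    have e2 := γ.comm (inclT (e := ⟨Triple.dom (γ.app g)⟩) (f := c) hn.2.1) rfl
    rw [hc, Category.comp_id] at e2
    rw [← e2] at e1
    refine Triple.hom_ext ((mor_incl_comp hn.1 _ (objLE_refl _)).symm.trans
      ((congrArg Triple.mor e1).trans ?_))
    exact congrArg (fun x => Mor.mk (𝟙 x)) (isMeet_unique hn (meet_spec _ _))

end Triples

/-- The inversive category of triples of an inductive groupoid. -/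
noncomputable def tripleCat (G : InductiveGrpd.{u}) : InversiveCat.{u} :=
  ⟨TripleCat G.carrier, tripleIncl, triple_isInversive⟩

/-- The functor between categories of triples induced by an inductive functor:
`[e, α, f⟩ ↦ [F e, F α, F f⟩`. -/
noncomputable def tripleMap {G H : Type u} [SmallGroupoid G] [SmallGroupoid H]
    [PartialOrder (Mor G)] [PartialOrder (Mor H)] [IsInductive G] [IsInductive H]
    (F : G ⥤ H) (hF : IsInductiveFunctor F) : TripleCat G ⥤ TripleCat H where
  obj e := ⟨F.obj e.of⟩
  map T := Triple.mk (F.map T.arr) (by simpa [ObjLE] using hF.map_le _ _ T.dom_le)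
    (by simpa [ObjLE] using hF.map_le _ _ T.cod_le)
  map_id e := Triple.hom_ext (congrArg Mor.mk (F.map_id e.of))
  map_comp T S := by
    refine Triple.hom_ext (IsPP.unique ?_ (Triple.isPP _ _))
    have h := isPP_of_isMeet (hF.map_meet _ _ _ (meet_spec T.cod S.dom))
      (hF.map_le _ _ (corestr_le T.arr (meet_spec T.cod S.dom).1))
      (hF.map_le _ _ (restr_le S.arr (meet_spec T.cod S.dom).2.1))
    rw [← F.map_comp] at h
    exact h

/-- The functor `IG ⥤ IC` sending an inductive groupoid to its category of triples. -/
noncomputable def tripleFunctor : InductiveGrpd.{u} ⥤ InversiveCat.{u} where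
  obj := tripleCat
  map {G H} F :=
    { functor := tripleMap F.functor F.inductive'
      inversive :=
        { map_incl := fun {a b} f hf => by
            obtain ⟨h, rfl⟩ := (incl_iff f).1 hf
            exact congrArg Mor.mk (F.functor.map_id a.of)
          map_meet := fun a b d h =>
            triple_isMeet.2 (F.inductive'.map_meet _ _ _ (triple_isMeet.1 h)) } }
  map_id _ := rfl
  map_comp _ _ := rfl

end IGIC

/-! Both round trips fix the objects up to relabelling, and each is a bijection on hom-sets, so unit
and counit can be built as isomorphisms of structures, with functor composites equal to identities.

For an inductive groupoid, a triple `[a, α, b⟩` is invertible exactly when `α` runs from all of `a`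
to all of `b`; hence the isomorphisms between triples are the morphisms of the groupoid
(`isoT_bijective`). The two orders agree because an inclusion followed by an isomorphism `y` has the
restriction of `y` as its groupoid component (`isoT_le_iff`).

For an inversive category, a retraction or an inclusion is determined by its endpoints. A normal
factorisation `θ ≫ σ ≫ ι` is therefore the same data as the triple with arrow `σ`, and its existence
and uniqueness give a bijection between triples and morphisms. This correspondence is kept as a
relation, `Realizes`, so that existence and uniqueness can be used in both directions.

The substance is compatibility with composition (`realizes_comp`). In `θ σ ι θ' σ' ι'` the core
axiom replaces `ι θ'` by a retraction onto the meet `h` followed by an inclusion. The retraction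
slides left past `σ`, turning it into its corestriction to `h`; the inclusion slides right past
`σ'`, turning it into its restriction to `h`. What remains is a normal factorisation whose
isomorphism is the product defining the composition of triples. -/

namespace IGIC

/-! ### Isomorphisms in the category of triples, and the unit -/

section Unit

variable {G : Type u} [SmallGroupoid G] [PartialOrder (Mor G)] [IsInductive G]

/-- Any factor lying below an identity is itself an identity, so the product collapses to its second
factor, which lies below the arrow of `T`. -/
theorem mor_incl_comp_le {e f g : TripleCat G} (h : ObjLE e.of f.of) (T : f ⟶ g) :
    Triple.mor (inclT h ≫ T) ≤ Triple.mor T := by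
  obtain ⟨⟨x, y, z, u, v, hu, hv, e₁⟩, -⟩ := Triple.isPP (inclT h) T
  obtain rfl : y = x := congrArg Mor.cod (eq_id_of_le hu)
  obtain rfl : u = 𝟙 y := by simpa using eq_id_of_le hu
  rw [e₁, Category.id_comp]
  exact hv

/-- Injectivity holds because the arrow can be read off the triple. For surjectivity, a composite of
triples can only shrink the domain and codomain, so invertibility forces both to be maximal. -/
theorem isoT_bijective (a b : G) :
    Function.Bijective (isoT : (a ⟶ b) → ((⟨a⟩ : TripleCat G) ≅ ⟨b⟩)) := by
  refine ⟨fun α β h => ?_, fun s => ?_⟩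
  · have h1 : Mor.mk α = Mor.mk β := congrArg (fun s => Triple.mor (Iso.hom s)) h
    simpa using h1
  · obtain ⟨s, t, h, h'⟩ := s
    have h1 := dom_of_comp_eq_id s t h
    have h2 := cod_of_comp_eq_id s t h'
    obtain ⟨σ, l, l'⟩ := s
    dsimp only at h1 h2
    subst h1
    subst h2
    exact ⟨σ, Iso.ext rfl⟩

theorem isoT_id (a : G) : isoT (𝟙 a) = Iso.refl (⟨a⟩ : TripleCat G) := Iso.ext rfl

theorem isoT_comp {a b c : G} (α : a ⟶ b) (β : b ⟶ c) : isoT (α ≫ β) = isoT α ≪≫ isoT β :=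
  Iso.ext (Triple.hom_ext ((isPP_comp α β).unique (Triple.isPP (isoT α).hom (isoT β).hom)))

/-- The order on isomorphisms amounts to commuting squares with inclusions. Following by an
inclusion does not change the groupoid component, and preceding by one can only lower it, so a
square says exactly that `x` lies below `y`. -/
theorem isoT_le_iff {a b a' b' : G} (x : a ⟶ b) (y : a' ⟶ b') :
    IsoLE tripleIncl (Mor.mk (CoreHom.mk (isoT x) : (⟨⟨a⟩⟩ : Core (TripleCat G)) ⟶ ⟨⟨b⟩⟩))
      (Mor.mk (CoreHom.mk (isoT y) : (⟨⟨a'⟩⟩ : Core (TripleCat G)) ⟶ ⟨⟨b'⟩⟩)) ↔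
      Mor.mk x ≤ Mor.mk y := by
  rw [isoLE_iff triple_isSubobjectCategory]
  constructor
  · rintro ⟨i, j, hi, hj, h⟩
    obtain ⟨hi', rfl⟩ := (incl_iff i).1 hi
    obtain ⟨hj', rfl⟩ := (incl_iff j).1 hj
    have h1 := mor_incl_comp_le hi' (isoT y).hom
    rw [show inclT hi' ≫ (isoT y).hom = (isoT x).hom ≫ inclT hj' from h, mor_comp_incl] at h1
    exact h1
  · intro h
    refine ⟨inclT (dom_le h), inclT (cod_le h), rfl, rfl, Triple.hom_ext ?_⟩
    refine ((Triple.isPP _ _).unique ?_).trans (mor_comp_incl (isoT x).hom _).symm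
    -- As `a ≤ a'`, the meet of `a` and `a'` is `a`, so the composite of the inclusion with `y` has
    -- component `𝟙 a ≫ x`.
    have h1 := isPP_of_isMeet (u := 𝟙 a) (v := x)
      ⟨objLE_refl a, dom_le h, fun _ hx _ => hx⟩ (le_refl (Mor.mk (𝟙 a))) h
    rwa [Category.id_comp] at h1

variable (G)

/-- An inductive groupoid maps to the isomorphisms of its category of triples. -/
noncomputable def toCoreTriple : G ⥤ Core (TripleCat G) where
  obj a := ⟨⟨a⟩⟩
  map α := ⟨isoT α⟩
  map_id a := Core.hom_ext (congrArg Iso.hom (isoT_id a))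
  map_comp α β := Core.hom_ext (congrArg Iso.hom (isoT_comp α β))

/-- The inverse of `toCoreTriple`. -/
noncomputable def ofCoreTriple : Core (TripleCat G) ⥤ G where
  obj x := x.of.of
  map f := ((isoT_bijective _ _).2 f.iso).choose
  -- Both functor laws are checked after applying the injective `isoT`, which undoes the choice of
  -- preimage.
  map_id x := (isoT_bijective _ _).1
    (((isoT_bijective _ _).2 (CoreHom.iso (𝟙 x))).choose_spec.trans (isoT_id _).symm)
  map_comp f g := (isoT_bijective _ _).1
    (((isoT_bijective _ _).2 (CoreHom.iso (f ≫ g))).choose_spec.trans (by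
      rw [isoT_comp, ((isoT_bijective _ _).2 f.iso).choose_spec,
        ((isoT_bijective _ _).2 g.iso).choose_spec]
      rfl))

variable {G}

theorem isoT_ofCoreTriple_map {x y : Core (TripleCat G)} (f : x ⟶ y) :
    isoT ((ofCoreTriple G).map f) = f.iso :=
  ((isoT_bijective _ _).2 f.iso).choose_spec

theorem toCoreTriple_comp_ofCoreTriple : toCoreTriple G ⋙ ofCoreTriple G = 𝟭 G :=
  Functor.hext (fun _ => rfl) fun _ _ _ =>
    heq_of_eq ((isoT_bijective _ _).1 (isoT_ofCoreTriple_map _))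

theorem ofCoreTriple_comp_toCoreTriple : ofCoreTriple G ⋙ toCoreTriple G = 𝟭 _ :=
  Functor.hext (fun _ => rfl) fun _ _ f =>
    heq_of_eq (Core.hom_ext (congrArg Iso.hom (isoT_ofCoreTriple_map f)))

end Unit

/-- An inductive groupoid is isomorphic to the groupoid of isomorphisms of its category of
triples. -/
noncomputable def unitIso (G : InductiveGrpd.{u}) : G ≅ isoFunctor.obj (tripleFunctor.obj G) where
  hom := ⟨toCoreTriple G.carrier,
    { map_le := fun x y h => (isoT_le_iff x y).2 h
      map_meet := fun a b d h =>
        (iso_isMeet triple_isInversive _ _ _).2 (triple_isMeet.2 h) }⟩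
  inv := ⟨ofCoreTriple G.carrier,
    { map_le := fun x y h => by
        refine (isoT_le_iff _ _).1 ?_
        rw [isoT_ofCoreTriple_map x, isoT_ofCoreTriple_map y]
        exact h
      map_meet := fun a b d h =>
        triple_isMeet.1 ((iso_isMeet triple_isInversive _ _ _).1 h) }⟩
  hom_inv_id := InductiveFunctor.ext toCoreTriple_comp_ofCoreTriple
  inv_hom_id := InductiveFunctor.ext ofCoreTriple_comp_toCoreTriple

/-- Both sides send `α` to the triple with arrow `F α` and full endpoints. -/
theorem unitIso_naturality {G H : InductiveGrpd.{u}} (F : G ⟶ H) :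
    F ≫ (unitIso H).hom = (unitIso G).hom ≫ isoFunctor.map (tripleFunctor.map F) :=
  InductiveFunctor.ext (Functor.hext (fun _ => rfl) fun _ _ _ =>
    heq_of_eq (Core.hom_ext (Triple.hom_ext rfl)))

/-! ### Retractions, normal factorisations and the counit -/

section Counit

variable {C : Type u} [SmallCategory C] {P : MorphismProperty C}

/-- There is at most one inclusion between two objects, and it splits in only one way. -/
theorem IsInversive.retraction_unique (hP : IsInversive P) {a b : C} {q q' : a ⟶ b}
    (hq : IsRetraction P q) (hq' : IsRetraction P q') : q = q' := by
  obtain ⟨i, hi, h⟩ := hq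
  obtain ⟨i', hi', h'⟩ := hq'
  obtain rfl := hP.thin _ _ hi hi'
  exact (hP.splits i hi).unique h h'

theorem IsInversive.exists_retraction (hP : IsInversive P) {a b : C} (h : SubLE P b a) :
    ∃ q : a ⟶ b, IsRetraction P q := by
  obtain ⟨i, hi⟩ := h
  obtain ⟨q, hq, -⟩ := hP.splits i hi
  exact ⟨q, i, hi, hq⟩

theorem IsSubobjectCategory.isRetraction_id (hP : IsSubobjectCategory P) (a : C) :
    IsRetraction P (𝟙 a) := ⟨𝟙 a, hP.id_mem a, by simp⟩

theorem IsSubobjectCategory.isRetraction_comp (hP : IsSubobjectCategory P) {a b c : C}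
    {q : a ⟶ b} {r : b ⟶ c} (hq : IsRetraction P q) (hr : IsRetraction P r) :
    IsRetraction P (q ≫ r) := by
  obtain ⟨i, hi, h⟩ := hq
  obtain ⟨j, hj, h'⟩ := hr
  exact ⟨j ≫ i, hP.comp_mem _ _ hj hi, by simp [reassoc_of% h, h']⟩

theorem IsInversiveFunctor.map_retraction {D : Type u} [SmallCategory D]
    {Q : MorphismProperty D} {F : C ⥤ D} (hF : IsInversiveFunctor P Q F) {a b : C} {q : a ⟶ b}
    (hq : IsRetraction P q) : IsRetraction Q (F.map q) := by
  obtain ⟨i, hi, h⟩ := hq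
  exact ⟨F.map i, hF.map_incl i hi, by rw [← F.map_comp, h, F.map_id]⟩

/-- An inclusion followed by a retraction factors through the meet. -/
theorem IsInversive.incl_comp_retraction (hP : IsInversive P) {b f c h : C} {i : b ⟶ f}
    {q : f ⟶ c} (hi : P i) (hq : IsRetraction P q) (hh : IsMeet (SubLE P) b c h) :
    ∃ (r : b ⟶ h) (j : h ⟶ c), IsRetraction P r ∧ P j ∧ i ≫ q = r ≫ j := by
  -- This is the core axiom for a word with one inclusion and one retraction, started at the empty
  -- word on `b`.
  simpa using hP.core_fac _ (CoreWord.snoc _ i q (CoreWord.nil b) hi hq hh)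

/-- A commutative square of isomorphisms and inclusions yields one of isomorphisms and
retractions. -/
theorem IsInversive.iso_comp_retraction (hP : IsInversive P) {a b a' b' : C} (f : a ≅ b)
    (g : a' ≅ b') {i : a ⟶ a'} {j : b ⟶ b'} {q : a' ⟶ a} {r : b' ⟶ b} (hi : P i) (hj : P j)
    (h : i ≫ g.hom = f.hom ≫ j) (hq : IsRetraction P q) (hr : IsRetraction P r) :
    g.hom ≫ r = q ≫ f.hom := by
  obtain ⟨j', hj', hjr⟩ := hr
  obtain rfl := hP.thin _ _ hj hj'
  -- It suffices that `g.hom ≫ r ≫ f.inv` splits `i`, since `q` is the only splitting of `i`.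
  rw [← Iso.comp_inv_eq, Category.assoc]
  refine hP.retraction_unique ⟨i, hi, ?_⟩ hq
  rw [reassoc_of% h, reassoc_of% hjr, Iso.hom_inv_id]

/-- The morphism `f` is the composite of a retraction, the isomorphism in the triple `T` and an
inclusion. -/
def Realizes (hP : IsInversive P) {e f : TripleCat (Core C)}
    (T : @Triple (Core C) _ (isoOrder hP) e f) (φ : e.of.of ⟶ f.of.of) : Prop :=
  letI := isoOrder hP
  ∃ (q : e.of.of ⟶ T.dom.of) (i : T.cod.of ⟶ f.of.of),
    IsRetraction P q ∧ P i ∧ q ≫ T.arr.iso.hom ≫ i = φ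

variable (hP : IsInversive P)

/-- With the next three lemmas, this makes `Realizes` a bijection between triples and morphisms. The
order on isomorphisms depends on `hP`, so it is introduced by `letI` ahead of the quantifiers. -/
theorem realizes_exists :
    letI := isoOrder hP
    ∀ {e f : TripleCat (Core C)} (T : Triple e f), ∃ φ, Realizes hP T φ := by
  let := isoOrder hP
  intro e f T
  obtain ⟨q, hq⟩ := hP.exists_retraction ((iso_objLE hP _ _).1 T.dom_le)
  obtain ⟨i, hi⟩ := (iso_objLE hP _ _).1 T.cod_le
  exact ⟨_, q, i, hq, hi, rfl⟩

theorem realizes_unique :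
    letI := isoOrder hP
    ∀ {e f : TripleCat (Core C)} {T : Triple e f} {φ ψ : e.of.of ⟶ f.of.of},
      Realizes hP T φ → Realizes hP T ψ → φ = ψ := by
  rintro e f T _ _ ⟨q, i, hq, hi, rfl⟩ ⟨q', i', hq', hi', rfl⟩
  obtain rfl := hP.retraction_unique hq hq'
  obtain rfl := hP.thin _ _ hi hi'
  rfl

theorem realizes_surjective :
    letI := isoOrder hP
    ∀ {e f : TripleCat (Core C)} (φ : e.of.of ⟶ f.of.of), ∃ T : Triple e f, Realizes hP T φ := by
  let := isoOrder hP
  intro e f φ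
  obtain ⟨n⟩ := hP.exists_fac φ
  obtain ⟨i, hi, h⟩ := n.isRetraction
  exact ⟨⟨(⟨n.iso⟩ : (⟨n.coim⟩ : Core C) ⟶ ⟨n.im⟩), (iso_objLE hP _ _).2 ⟨i, hi⟩,
    (iso_objLE hP _ _).2 ⟨_, n.isInclusion⟩⟩, n.retr, n.incl, n.isRetraction, n.isInclusion, n.fac⟩

/-- Two triples realised by `φ` are two normal factorisations of `φ`, and these coincide. -/
theorem realizes_injective :
    letI := isoOrder hP
    ∀ {e f : TripleCat (Core C)} {T S : Triple e f} {φ : e.of.of ⟶ f.of.of},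
      Realizes hP T φ → Realizes hP S φ → T = S := by
  rintro e f ⟨t, _, _⟩ ⟨s, _, _⟩ φ ⟨q, i, hq, hi, h⟩ ⟨q', i', hq', hi', h'⟩
  rename_i a b _ _ a' b' _ _
  obtain ⟨a⟩ := a
  obtain ⟨b⟩ := b
  obtain ⟨a'⟩ := a'
  obtain ⟨b'⟩ := b'
  obtain ⟨t⟩ := t
  obtain ⟨s⟩ := s
  have := hP.fac_unique φ
  have key : (⟨_, _, q, t, i, hq, hi, h⟩ : NormalFactorisation P φ) =
    ⟨_, _, q', s, i', hq', hi', h'⟩ := Subsingleton.elim _ _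
  injection key with h1 h2 _ h3 _
  subst h1
  subst h2
  obtain rfl := eq_of_heq h3
  rfl

theorem realizes_id :
    letI := isoOrder hP
    haveI := iso_isInductive hP
    ∀ e : TripleCat (Core C), Realizes hP (𝟙 e : e ⟶ e) (𝟙 e.of.of) := by
  intro e
  refine ⟨𝟙 _, 𝟙 _, hP.isRetraction_id _, hP.id_mem _, ?_⟩
  change 𝟙 e.of.of ≫ 𝟙 e.of.of ≫ 𝟙 e.of.of = 𝟙 e.of.of
  simp

theorem realizes_incl :
    letI := isoOrder hP
    haveI := iso_isInductive hP
    ∀ {e f : TripleCat (Core C)} (h : ObjLE e.of f.of) {i : e.of.of ⟶ f.of.of}, P i →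
      Realizes hP (inclT h) i := by
  intro e f h i hi
  refine ⟨𝟙 _, i, hP.isRetraction_id _, hi, ?_⟩
  change 𝟙 e.of.of ≫ 𝟙 e.of.of ≫ i = i
  simp

theorem realizes_comp :
    letI := isoOrder hP
    haveI := iso_isInductive hP
    ∀ {e f g : TripleCat (Core C)} (T : e ⟶ f) (S : f ⟶ g) {φ : e.of.of ⟶ f.of.of}
      {ψ : f.of.of ⟶ g.of.of}, Realizes hP T φ → Realizes hP S ψ →
      Realizes hP (T ≫ S) (φ ≫ ψ) := by
  let := isoOrder hP
  have := iso_isInductive hP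
  rintro e f g T S _ _ ⟨q, i, hq, hi, rfl⟩ ⟨q', i', hq', hi', rfl⟩
  have hm := meet_spec (Triple.cod T) (Triple.dom S)
  obtain ⟨r, j, hr, hj, h⟩ := hP.incl_comp_retraction hi hq' ((iso_isMeet hP _ _ _).1 hm)
  obtain ⟨k, l, hk, hl, h₁⟩ := (isoLE_iff hP.toIsSubobjectCategory _ _).1
    (corestr_le (Triple.arr T) hm.1)
  obtain ⟨k', l', hk', hl', h₂⟩ := (isoLE_iff hP.toIsSubobjectCategory _ _).1
    (restr_le (Triple.arr S) hm.2.1)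
  -- The inclusion of the meet produced by the core axiom is the one along which the arrow of `S` is
  -- restricted.
  obtain rfl := hP.thin _ _ hj hk'
  obtain ⟨p, hp⟩ := hP.exists_retraction ⟨k, hk⟩
  -- The retraction `r` onto the meet passes to the left of the arrow of `T`, leaving its
  -- corestriction.
  have h₃ := hP.iso_comp_retraction _ _ hk hl h₁ hp hr
  refine ⟨q ≫ p, l' ≫ i', hP.isRetraction_comp hq hp, hP.comp_mem _ _ hl' hi', ?_⟩
  change (q ≫ p) ≫ ((corestr (Triple.arr T) hm.1).iso.hom ≫
    (restr (Triple.arr S) hm.2.1).iso.hom) ≫ l' ≫ i' = _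
  simp only [Category.assoc]
  rw [reassoc_of% h, reassoc_of% h₃, reassoc_of% h₂]

/-- The category of triples of the isomorphisms of `C` maps to `C`:
`[e, α, f⟩ ↦ q(e, dom α) ≫ α ≫ ι(cod α, f)`. -/
noncomputable def ofTripleCore :
    letI := isoOrder hP
    haveI := iso_isInductive hP
    TripleCat (Core C) ⥤ C :=
  letI := isoOrder hP
  haveI := iso_isInductive hP
  { obj := fun e => e.of.of
    map := fun T => (realizes_exists hP T).choose
    -- In each functor law the two sides realise the same triple.
    map_id := fun e => realizes_unique hP (realizes_exists hP _).choose_spec (realizes_id hP e)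
    map_comp := fun T S => realizes_unique hP (realizes_exists hP _).choose_spec
      (realizes_comp hP T S (realizes_exists hP T).choose_spec
        (realizes_exists hP S).choose_spec) }

/-- The inverse of `ofTripleCore`, given by normal factorisations. -/
noncomputable def toTripleCore :
    letI := isoOrder hP
    haveI := iso_isInductive hP
    C ⥤ TripleCat (Core C) :=
  letI := isoOrder hP
  haveI := iso_isInductive hP
  { obj := fun c => ⟨⟨c⟩⟩
    map := fun φ => (realizes_surjective hP (e := ⟨⟨_⟩⟩) (f := ⟨⟨_⟩⟩) φ).choose
    -- Dually, in each law the same morphism realises both triples.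
    map_id := fun c => realizes_injective hP
      (realizes_surjective hP (e := ⟨⟨_⟩⟩) (f := ⟨⟨_⟩⟩) (𝟙 c)).choose_spec (realizes_id hP ⟨⟨c⟩⟩)
    map_comp := fun φ ψ => realizes_injective hP
      (realizes_surjective hP (e := ⟨⟨_⟩⟩) (f := ⟨⟨_⟩⟩) (φ ≫ ψ)).choose_spec
      (realizes_comp hP _ _ (realizes_surjective hP (e := ⟨⟨_⟩⟩) (f := ⟨⟨_⟩⟩) φ).choose_spec
        (realizes_surjective hP (e := ⟨⟨_⟩⟩) (f := ⟨⟨_⟩⟩) ψ).choose_spec) }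

theorem realizes_ofTripleCore_map :
    letI := isoOrder hP
    haveI := iso_isInductive hP
    ∀ {e f : TripleCat (Core C)} (T : e ⟶ f), Realizes hP T ((ofTripleCore hP).map T) :=
  fun T => (realizes_exists hP T).choose_spec

theorem realizes_toTripleCore_map {a b : C} (φ : a ⟶ b) :
    letI := isoOrder hP
    haveI := iso_isInductive hP
    Realizes hP ((toTripleCore hP).map φ) φ :=
  (realizes_surjective hP (e := ⟨⟨_⟩⟩) (f := ⟨⟨_⟩⟩) φ).choose_spec

theorem toTripleCore_comp_ofTripleCore :
    letI := isoOrder hP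
    haveI := iso_isInductive hP
    toTripleCore hP ⋙ ofTripleCore hP = 𝟭 C :=
  letI := isoOrder hP
  haveI := iso_isInductive hP
  Functor.hext (fun _ => rfl) fun _ _ φ => heq_of_eq
    (realizes_unique hP (realizes_ofTripleCore_map hP _) (realizes_toTripleCore_map hP φ))

theorem ofTripleCore_comp_toTripleCore :
    letI := isoOrder hP
    haveI := iso_isInductive hP
    ofTripleCore hP ⋙ toTripleCore hP = 𝟭 _ :=
  letI := isoOrder hP
  haveI := iso_isInductive hP
  Functor.hext (fun _ => rfl) fun _ _ T => heq_of_eq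
    (realizes_injective hP (realizes_toTripleCore_map hP _) (realizes_ofTripleCore_map hP T))

end Counit

/-- An inversive category is isomorphic to the category of triples of its groupoid of
isomorphisms. -/
noncomputable def counitIso (C : InversiveCat.{u}) :
    tripleFunctor.obj (isoFunctor.obj C) ≅ C where
  hom := ⟨ofTripleCore C.inversive,
    { map_incl := fun f hf => by
        let := isoOrder C.inversive
        have := iso_isInductive C.inversive
        obtain ⟨h, rfl⟩ := (incl_iff f).1 hf
        obtain ⟨i, hi⟩ := (iso_objLE C.inversive _ _).1 h
        have : (ofTripleCore C.inversive).map (inclT h) = i :=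
          realizes_unique C.inversive (realizes_ofTripleCore_map C.inversive _)
            (realizes_incl C.inversive h hi)
        exact this ▸ hi
      map_meet := fun a b d h => by
        let := isoOrder C.inversive
        have := iso_isInductive C.inversive
        exact (iso_isMeet C.inversive _ _ _).1 (triple_isMeet.1 h) }⟩
  inv := ⟨toTripleCore C.inversive,
    { map_incl := fun {a b} f hf => by
        let := isoOrder C.inversive
        have := iso_isInductive C.inversive
        have h : ObjLE (⟨a⟩ : Core C.carrier) ⟨b⟩ := (iso_objLE C.inversive _ _).2 ⟨f, hf⟩
        exact (incl_iff _).2 ⟨h, realizes_injective C.inversive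
          (realizes_toTripleCore_map C.inversive f)
          (realizes_incl C.inversive (e := ⟨⟨a⟩⟩) (f := ⟨⟨b⟩⟩) h hf)⟩
      map_meet := fun a b d h =>
        triple_isMeet.2 ((iso_isMeet C.inversive ⟨a⟩ ⟨b⟩ ⟨d⟩).2 h) }⟩
  hom_inv_id := InversiveFunctor.ext (ofTripleCore_comp_toTripleCore C.inversive)
  inv_hom_id := InversiveFunctor.ext (toTripleCore_comp_ofTripleCore C.inversive)

/-- An inversive functor preserves inclusions, hence retractions and normal factorisations, so the
image of a morphism realises the image of its triple. -/
theorem counitIso_naturality {C D : InversiveCat.{u}} (F : C ⟶ D) :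
    tripleFunctor.map (isoFunctor.map F) ≫ (counitIso D).hom = (counitIso C).hom ≫ F := by
  refine InversiveFunctor.ext (Functor.hext (fun _ => rfl) fun e f T => heq_of_eq ?_)
  refine realizes_unique D.inversive (realizes_ofTripleCore_map D.inversive _) ?_
  obtain ⟨q, i, hq, hi, h⟩ := realizes_ofTripleCore_map C.inversive T
  refine ⟨F.functor.map q, F.functor.map i, F.inversive.map_retraction hq,
    F.inversive.map_incl i hi, ?_⟩
  have h' : F.functor.map q ≫ F.functor.map T.arr.iso.hom ≫ F.functor.map i =
      F.functor.map (q ≫ T.arr.iso.hom ≫ i) := by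
    rw [Functor.map_comp, Functor.map_comp]
  exact h'.trans (congrArg F.functor.map h)

/-- The equivalence between inductive groupoids and inversive categories. -/
noncomputable def inductiveGrpdEquivInversiveCat : InductiveGrpd.{u} ≌ InversiveCat.{u} :=
  CategoryTheory.Equivalence.mk tripleFunctor isoFunctor
    (NatIso.ofComponents unitIso unitIso_naturality)
    (NatIso.ofComponents counitIso counitIso_naturality)

end IGIC

theorem mainTheorem4 :
    ∃ E : IGIC.InductiveGrpd.{u} ≌ IGIC.InversiveCat.{u},
      E.functor = IGIC.tripleFunctor.{u} ∧ E.inverse = IGIC.isoFunctor.{u} :=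
  -- `Equivalence.mk` adjusts only the unit, to obtain the triangle identity; the two functors are
  -- kept, so both equations are definitional.
  ⟨IGIC.inductiveGrpdEquivInversiveCat, rfl, rfl⟩
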